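/- **Definitions.** For $\mathbf d=(d_1,d_2)\in\mathbb Z^2$ let $\deg(\mathbf d)=d_1+d_2$, and order $\mathbb Z^2$ componentwise. A function $g\colon\mathbb Z^2\to\mathbb Z$ is *initially zero* (resp. *eventually zero*) if $g(\mathbf d)=0$ for all $\mathbf d$ of sufficiently small (resp. large) degree. A *Riemann function with offset* $C\in\mathbb Z$ is an initially zero $f\colon\mathbb Z^2\to\mathbb Z$ with $f(\mathbf d)=\deg(\mathbf d)+C$ for all $\mathbf d$ of sufficiently large degree. Its *weight* is the unique initially zero $W\colon\mathbb Z^2\to\mathbb Z$ with $f(\mathbf d)=\sum_{\mathbf d'\le\mathbf d}W(\mathbf d')$ for all $\mathbf d$, and for $\mathbf K\in\mathbb Z^2$ its *$\mathbf K$-dual* is $f^\wedge_{\mathbf K}(\mathbf d)=f(\mathbf K-\mathbf d)-\deg(\mathbf K-\mathbf d)-C$. A *perfect matching* is an initially and eventually zero $W\colon\mathbb Z^2\to\mathbb Z$ such that for some bijection $\pi\colon\mathbb Z\to\mathbb Z$ we have $W(i,j)=1$ if $j=\pi(i)$ and $W(i,j)=0$ otherwise. Let $k$ be a field. A *$k$-diagram*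 $\mathcal F$ consists of $k$-vector spaces $\mathcal F(B_1),\mathcal F(B_2),\mathcal F(B_3),\mathcal F(A_1),\mathcal F(A_2)$ and linear maps $\rho_{ij}\colon\mathcal F(B_i)\to\mathcal F(A_j)$ for $(i,j)\in\{(1,1),(2,2),(3,1),(3,2)\}$. Isomorphisms are families of linear isomorphisms of the five spaces that commute with the $\rho_{ij}$; direct sums are taken space by space. $H^0(\mathcal F)$ and $H^1(\mathcal F)$ are the kernel and the cokernel of $$\textstyle\bigoplus_{i=1}^{3}\mathcal F(B_i)\to\mathcal F(A_1)\oplus\mathcal F(A_2),\qquad (b_1,b_2,b_3)\mapsto(\rho_{11}b_1-\rho_{31}b_3,\ \rho_{22}b_2-\rho_{32}b_3),$$ $b^i(\mathcal F)=\dim_k H^i(\mathcal F)$, and $\mathcal F$ is *Fredholm* if $b^0(\mathcal F)$ and $b^1(\mathcal F)$ are finite. A *virtual Fredholm $k$-diagram* is a pair $\mathcal F_1\ominus\mathcal F_2$ of Fredholm $k$-diagrams; $\mathcal F_1\ominus\mathcal F_2\sim\mathcal F_1'\ominus\mathcal F_2'$ means $\mathcal F_1\oplus\mathcal F_2'\oplus\mathcal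 F_0\simeq\mathcal F_1'\oplus\mathcal F_2\oplus\mathcal F_0$ for some Fredholm $\mathcal F_0$. This is an equivalence relation, and $b^i(\mathcal F_1\ominus\mathcal F_2)=b^i(\mathcal F_1)-b^i(\mathcal F_2)\in\mathbb Z$ ($i=0,1$) and $\chi=b^0-b^1$ depend only on the equivalence class. For a perfect matching $W$ and $\mathbf d\in\mathbb Z^2$, $\mathcal M_{W,\mathbf d}$ is the $k$-diagram with $B_i=k^{\oplus\mathbb Z_{\le d_i}}$, $A_i=k^{\oplus\mathbb Z}$ and $\rho_{ii}$ the inclusion for $i=1,2$, with $B_3=k^{\oplus\{\mathbf a\,:\,W(\mathbf a)=1\}}$, and with $\rho_{3j}$ taking the basis vector $e_{(a_1,a_2)}$ to $e_{a_j}$ for $j=1,2$. It is Fredholm. **Proposition.** Let $k$ be a field, $f\colon\mathbb Z^2\to\mathbb Z$ a Riemann function with offset $C$ and weight $W$, and $\mathbf d\in\mathbb Z^2$. For any way of writing $$W=(W_1+\cdots+W_s)-(\tilde W_1+\cdots+\tilde W_{s-1})\qquad(s\ge 1)\tag{$*$}$$ with all $W_i$ and $\tilde W_i$ perfect matchings,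 let $[\mathcal M_{W,\mathbf d}]$ be the equivalence class of the virtual Fredholm $k$-diagram $$(\mathcal M_{W_1,\mathbf d}\oplus\cdots\oplus\mathcal M_{W_s,\mathbf d})\ominus(\mathcal M_{\tilde W_1,\mathbf d}\oplus\cdots\oplus\mathcal M_{\tilde W_{s-1},\mathbf d}).$$ Then $[\mathcal M_{W,\mathbf d}]$ does not depend on the way of writing $W$ in $(*)$ (including the choice of $s$), and for any way of writing $W$ as in $(*)$: 1. $b^0([\mathcal M_{W,\mathbf d}])=f(\mathbf d)$; 2. $b^1([\mathcal M_{W,\mathbf d}])=f^\wedge_{\mathbf K}(\mathbf K-\mathbf d)$ for every $\mathbf K\in\mathbb Z^2$; 3. $\chi([\mathcal M_{W,\mathbf d}])=\deg(\mathbf d)+C$. -/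

import Mathlib

open scoped DirectSum

universe u

/-! ### Riemann functions on `ℤ²`, weights, perfect matchings -/

/-- The degree of `d ∈ ℤ²`. The order on `ℤ × ℤ` is the componentwise one. -/
def deg (d : ℤ × ℤ) : ℤ := d.1 + d.2

/-- `f` vanishes in all sufficiently small degrees. -/
def InitiallyZero (f : ℤ × ℤ → ℤ) : Prop := ∃ a : ℤ, ∀ d, deg d ≤ a → f d = 0

/-- `f` vanishes in all sufficiently large degrees. -/
def EventuallyZero (f : ℤ × ℤ → ℤ) : Prop := ∃ b : ℤ, ∀ d, b ≤ deg d → f d = 0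

/-- `f` is a Riemann function with offset `C`. -/
def IsRiemannFunction (f : ℤ × ℤ → ℤ) (C : ℤ) : Prop :=
  InitiallyZero f ∧ ∃ b : ℤ, ∀ d, b ≤ deg d → f d = deg d + C

/-- The `K`-dual of a Riemann function `f` with offset `C`. -/
def dualFunction (f : ℤ × ℤ → ℤ) (C : ℤ) (K : ℤ × ℤ) (d : ℤ × ℤ) : ℤ :=
  f (K - d) - deg (K - d) - C

/-- `W` is the weight of `f`: it is initially zero and `f d = ∑_{d' ≤ d} W d'` for all `d`
(a finite sum, since `W` is initially zero). -/
def IsWeight (f W : ℤ × ℤ → ℤ) : Prop :=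
  InitiallyZero W ∧ ∀ d, f d = ∑ᶠ d' ∈ Set.Iic d, W d'

/-- A perfect matching: an initially and eventually zero indicator function of the graph of
a permutation of `ℤ`. -/
def IsPerfectMatching (W : ℤ × ℤ → ℤ) : Prop :=
  InitiallyZero W ∧ EventuallyZero W ∧
    ∃ π : Equiv.Perm ℤ, ∀ i j, W (i, j) = if j = π i then 1 else 0

/-- A way of writing `W = (W_1 + ⋯ + W_s) - (W̃_1 + ⋯ + W̃_{s-1})` with all `W_i`, `W̃_i` perfect
matchings; here `s = t + 1`. -/
structure MatchingDecomposition (W : ℤ × ℤ → ℤ) where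
  t : ℕ
  pos : Fin (t + 1) → ℤ × ℤ → ℤ
  neg : Fin t → ℤ × ℤ → ℤ
  pos_matching : ∀ i, IsPerfectMatching (pos i)
  neg_matching : ∀ i, IsPerfectMatching (neg i)
  eq_sub : W = ∑ i, pos i - ∑ i, neg i

/-! ### `k`-diagrams -/

/-- A `k`-diagram: five vector spaces and four restriction maps. -/
structure KDiagram (k : Type u) [Field k] where
  B1 : Type u
  B2 : Type u
  B3 : Type u
  A1 : Type u
  A2 : Type u
  [grpB1 : AddCommGroup B1]
  [grpB2 : AddCommGroup B2]
  [grpB3 : AddCommGroup B3]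
  [grpA1 : AddCommGroup A1]
  [grpA2 : AddCommGroup A2]
  [modB1 : Module k B1]
  [modB2 : Module k B2]
  [modB3 : Module k B3]
  [modA1 : Module k A1]
  [modA2 : Module k A2]
  r11 : B1 →ₗ[k] A1
  r22 : B2 →ₗ[k] A2
  r31 : B3 →ₗ[k] A1
  r32 : B3 →ₗ[k] A2

attribute [instance] KDiagram.grpB1 KDiagram.grpB2 KDiagram.grpB3 KDiagram.grpA1 KDiagram.grpA2
attribute [instance] KDiagram.modB1 KDiagram.modB2 KDiagram.modB3 KDiagram.modA1 KDiagram.modA2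

namespace KDiagram

variable {k : Type u} [Field k]

/-- The differential `(b₁, b₂, b₃) ↦ (ρ₁₁ b₁ - ρ₃₁ b₃, ρ₂₂ b₂ - ρ₃₂ b₃)`. -/
def differential (F : KDiagram k) : (F.B1 × F.B2 × F.B3) →ₗ[k] (F.A1 × F.A2) :=
  LinearMap.prod
    (F.r11 ∘ₗ LinearMap.fst k _ _ - F.r31 ∘ₗ LinearMap.snd k _ _ ∘ₗ LinearMap.snd k _ _)
    (F.r22 ∘ₗ LinearMap.fst k _ _ ∘ₗ LinearMap.snd k _ _
      - F.r32 ∘ₗ LinearMap.snd k _ _ ∘ₗ LinearMap.snd k _ _)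

theorem differential_apply (F : KDiagram k) (b : F.B1 × F.B2 × F.B3) :
    F.differential b = (F.r11 b.1 - F.r31 b.2.2, F.r22 b.2.1 - F.r32 b.2.2) := rfl

/-- The zeroth cohomology group. -/
abbrev H0 (F : KDiagram k) : Type u := LinearMap.ker F.differential

/-- The first cohomology group. -/
abbrev H1 (F : KDiagram k) : Type u := (F.A1 × F.A2) ⧸ LinearMap.range F.differential

/-- Both Betti numbers are finite. -/
def IsFredholm (F : KDiagram k) : Prop := Module.Finite k F.H0 ∧ Module.Finite k F.H1

/-- The zeroth Betti number (meaningful for Fredholm diagrams). -/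
noncomputable def b0 (F : KDiagram k) : ℕ := Module.finrank k F.H0

/-- The first Betti number (meaningful for Fredholm diagrams). -/
noncomputable def b1 (F : KDiagram k) : ℕ := Module.finrank k F.H1

/-- An isomorphism of `k`-diagrams: linear isomorphisms of all values that commute with the
restriction maps. -/
structure Iso (F G : KDiagram k) where
  eB1 : F.B1 ≃ₗ[k] G.B1
  eB2 : F.B2 ≃ₗ[k] G.B2
  eB3 : F.B3 ≃ₗ[k] G.B3
  eA1 : F.A1 ≃ₗ[k] G.A1
  eA2 : F.A2 ≃ₗ[k] G.A2
  comm11 : ∀ x, G.r11 (eB1 x) = eA1 (F.r11 x)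
  comm22 : ∀ x, G.r22 (eB2 x) = eA2 (F.r22 x)
  comm31 : ∀ x, G.r31 (eB3 x) = eA1 (F.r31 x)
  comm32 : ∀ x, G.r32 (eB3 x) = eA2 (F.r32 x)

/-- The direct sum of two `k`-diagrams. -/
def sum (F G : KDiagram k) : KDiagram k where
  B1 := F.B1 × G.B1
  B2 := F.B2 × G.B2
  B3 := F.B3 × G.B3
  A1 := F.A1 × G.A1
  A2 := F.A2 × G.A2
  r11 := F.r11.prodMap G.r11
  r22 := F.r22.prodMap G.r22
  r31 := F.r31.prodMap G.r31
  r32 := F.r32.prodMap G.r32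

/-- The direct sum of a family of `k`-diagrams. -/
noncomputable def directSum {ι : Type} (F : ι → KDiagram k) : KDiagram k where
  B1 := ⨁ i, (F i).B1
  B2 := ⨁ i, (F i).B2
  B3 := ⨁ i, (F i).B3
  A1 := ⨁ i, (F i).A1
  A2 := ⨁ i, (F i).A2
  r11 := DirectSum.lmap fun i => (F i).r11
  r22 := DirectSum.lmap fun i => (F i).r22
  r31 := DirectSum.lmap fun i => (F i).r31
  r32 := DirectSum.lmap fun i => (F i).r32

/-- The multiset on `ℤ²` with multiplicities `W`. -/
def Multi (W : ℤ × ℤ → ℕ∞) : Type := {p : (ℤ × ℤ) × ℕ // 1 ≤ p.2 ∧ (p.2 : ℕ∞) ≤ W p.1}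

/-- The `k`-diagram `M_{W,d}`: `B_i = k^{⊕ ℤ_{≤ d_i}}` and `A_i = k^{⊕ ℤ}` for `i = 1, 2`, with
the inclusions, and `B_3 = k^{⊕ W}` with the two projections. -/
noncomputable def M (k : Type u) [Field k] (W : ℤ × ℤ → ℕ∞) (d : ℤ × ℤ) : KDiagram k where
  B1 := {i : ℤ // i ≤ d.1} →₀ k
  B2 := {j : ℤ // j ≤ d.2} →₀ k
  B3 := Multi W →₀ k
  A1 := ℤ →₀ k
  A2 := ℤ →₀ k
  r11 := Finsupp.lmapDomain k k Subtype.val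
  r22 := Finsupp.lmapDomain k k Subtype.val
  r31 := Finsupp.lmapDomain k k fun p : Multi W => p.1.1.1
  r32 := Finsupp.lmapDomain k k fun p : Multi W => p.1.1.2

/-- `M_{W,d}` for a non-negative integer valued `W`, such as a perfect matching. -/
noncomputable def MInt (k : Type u) [Field k] (W : ℤ × ℤ → ℤ) (d : ℤ × ℤ) : KDiagram k :=
  M k (fun a => ((W a).toNat : ℕ∞)) d

/-! ### Isomorphisms and direct sums -/

/-- The identity isomorphism. -/
def Iso.refl (F : KDiagram k) : Iso F F where
  eB1 := LinearEquiv.refl k _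
  eB2 := LinearEquiv.refl k _
  eB3 := LinearEquiv.refl k _
  eA1 := LinearEquiv.refl k _
  eA2 := LinearEquiv.refl k _
  comm11 _ := rfl
  comm22 _ := rfl
  comm31 _ := rfl
  comm32 _ := rfl

/-- The inverse isomorphism. -/
def Iso.symm {F G : KDiagram k} (e : Iso F G) : Iso G F where
  eB1 := e.eB1.symm
  eB2 := e.eB2.symm
  eB3 := e.eB3.symm
  eA1 := e.eA1.symm
  eA2 := e.eA2.symm
  comm11 x := by rw [LinearEquiv.eq_symm_apply, ← e.comm11, LinearEquiv.apply_symm_apply]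
  comm22 x := by rw [LinearEquiv.eq_symm_apply, ← e.comm22, LinearEquiv.apply_symm_apply]
  comm31 x := by rw [LinearEquiv.eq_symm_apply, ← e.comm31, LinearEquiv.apply_symm_apply]
  comm32 x := by rw [LinearEquiv.eq_symm_apply, ← e.comm32, LinearEquiv.apply_symm_apply]

/-- Composition of isomorphisms. -/
def Iso.trans {F G H : KDiagram k} (e : Iso F G) (e' : Iso G H) : Iso F H where
  eB1 := e.eB1.trans e'.eB1
  eB2 := e.eB2.trans e'.eB2
  eB3 := e.eB3.trans e'.eB3
  eA1 := e.eA1.trans e'.eA1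
  eA2 := e.eA2.trans e'.eA2
  comm11 x := by simp [e.comm11, e'.comm11]
  comm22 x := by simp [e.comm22, e'.comm22]
  comm31 x := by simp [e.comm31, e'.comm31]
  comm32 x := by simp [e.comm32, e'.comm32]

/-- The direct sum of two isomorphisms. -/
def Iso.sumCongr {F G F' G' : KDiagram k} (e : Iso F F') (e' : Iso G G') :
    Iso (F.sum G) (F'.sum G') where
  eB1 := e.eB1.prodCongr e'.eB1
  eB2 := e.eB2.prodCongr e'.eB2
  eB3 := e.eB3.prodCongr e'.eB3
  eA1 := e.eA1.prodCongr e'.eA1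
  eA2 := e.eA2.prodCongr e'.eA2
  comm11 x := Prod.ext (e.comm11 x.1) (e'.comm11 x.2)
  comm22 x := Prod.ext (e.comm22 x.1) (e'.comm22 x.2)
  comm31 x := Prod.ext (e.comm31 x.1) (e'.comm31 x.2)
  comm32 x := Prod.ext (e.comm32 x.1) (e'.comm32 x.2)

/-- `F ⊕ G ≃ G ⊕ F`. -/
def Iso.sumComm (F G : KDiagram k) : Iso (F.sum G) (G.sum F) where
  eB1 := LinearEquiv.prodComm k F.B1 G.B1
  eB2 := LinearEquiv.prodComm k F.B2 G.B2
  eB3 := LinearEquiv.prodComm k F.B3 G.B3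
  eA1 := LinearEquiv.prodComm k F.A1 G.A1
  eA2 := LinearEquiv.prodComm k F.A2 G.A2
  comm11 _ := rfl
  comm22 _ := rfl
  comm31 _ := rfl
  comm32 _ := rfl

/-- `(F ⊕ G) ⊕ H ≃ F ⊕ (G ⊕ H)`. -/
def Iso.sumAssoc (F G H : KDiagram k) : Iso ((F.sum G).sum H) (F.sum (G.sum H)) where
  eB1 := LinearEquiv.prodAssoc k F.B1 G.B1 H.B1
  eB2 := LinearEquiv.prodAssoc k F.B2 G.B2 H.B2
  eB3 := LinearEquiv.prodAssoc k F.B3 G.B3 H.B3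
  eA1 := LinearEquiv.prodAssoc k F.A1 G.A1 H.A1
  eA2 := LinearEquiv.prodAssoc k F.A2 G.A2 H.A2
  comm11 _ := rfl
  comm22 _ := rfl
  comm31 _ := rfl
  comm32 _ := rfl

/-- Being isomorphic, as an equivalence relation. -/
def isoSetoid (k : Type u) [Field k] : Setoid (KDiagram k) where
  r F G := Nonempty (Iso F G)
  iseqv :=
    { refl := fun F => ⟨Iso.refl F⟩
      symm := fun ⟨e⟩ => ⟨e.symm⟩
      trans := fun ⟨e⟩ ⟨e'⟩ => ⟨e.trans e'⟩ }

/-- Isomorphism classes of `k`-diagrams. -/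
def IsoClass (k : Type u) [Field k] : Type (u + 1) := Quotient (isoSetoid k)

/-- The isomorphism class of a `k`-diagram. -/
def toIsoClass (F : KDiagram k) : IsoClass k := Quotient.mk (isoSetoid k) F

theorem toIsoClass_eq_iff {F G : KDiagram k} :
    F.toIsoClass = G.toIsoClass ↔ Nonempty (Iso F G) := Quotient.eq

instance : AddCommSemigroup (IsoClass k) where
  add := Quotient.map₂ KDiagram.sum fun _ _ ⟨e⟩ _ _ ⟨e'⟩ => ⟨e.sumCongr e'⟩
  add_assoc := by
    rintro ⟨F⟩ ⟨G⟩ ⟨H⟩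
    exact Quotient.sound ⟨Iso.sumAssoc F G H⟩
  add_comm := by
    rintro ⟨F⟩ ⟨G⟩
    exact Quotient.sound ⟨Iso.sumComm F G⟩

theorem toIsoClass_sum (F G : KDiagram k) :
    (F.sum G).toIsoClass = F.toIsoClass + G.toIsoClass := rfl

/-! ### Cohomology of isomorphic diagrams and of direct sums -/

/-- An isomorphism of diagrams induces an isomorphism on `H⁰`. -/
def Iso.H0Equiv {F G : KDiagram k} (e : Iso F G) : F.H0 ≃ₗ[k] G.H0 :=
  (e.eB1.prodCongr (e.eB2.prodCongr e.eB3)).ofSubmodules _ _ (by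
    ext y
    obtain ⟨⟨x1, x2, x3⟩, rfl⟩ := (e.eB1.prodCongr (e.eB2.prodCongr e.eB3)).surjective y
    simp only [Submodule.mem_map, LinearMap.mem_ker, differential_apply, Prod.mk_eq_zero]
    constructor
    · rintro ⟨x, ⟨h1, h2⟩, hx⟩
      have hx' := (e.eB1.prodCongr (e.eB2.prodCongr e.eB3)).injective hx
      subst hx'
      simp only [LinearEquiv.prodCongr_apply, e.comm11, e.comm22, e.comm31, e.comm32, ← map_sub]
      exact ⟨by rw [h1, map_zero], by rw [h2, map_zero]⟩
    · intro h
      simp only [LinearEquiv.prodCongr_apply, e.comm11, e.comm22, e.comm31, e.comm32,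
        ← map_sub, LinearEquiv.map_eq_zero_iff] at h
      exact ⟨_, h, rfl⟩)

/-- An isomorphism of diagrams induces an isomorphism on `H¹`. -/
def Iso.H1Equiv {F G : KDiagram k} (e : Iso F G) : F.H1 ≃ₗ[k] G.H1 :=
  Submodule.Quotient.equiv _ _ (e.eA1.prodCongr e.eA2) (by
    ext y
    simp only [Submodule.mem_map, LinearMap.mem_range]
    constructor
    · rintro ⟨_, ⟨x, rfl⟩, rfl⟩
      refine ⟨(e.eB1 x.1, e.eB2 x.2.1, e.eB3 x.2.2), ?_⟩
      simp [differential_apply, e.comm11, e.comm22, e.comm31, e.comm32]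
    · rintro ⟨x, rfl⟩
      refine ⟨_, ⟨(e.eB1.symm x.1, e.eB2.symm x.2.1, e.eB3.symm x.2.2), rfl⟩, ?_⟩
      simp [differential_apply, ← e.comm11, ← e.comm22, ← e.comm31, ← e.comm32])

/-- `H⁰` commutes with direct sums. -/
def H0Sum (F G : KDiagram k) : (F.sum G).H0 ≃ₗ[k] F.H0 × G.H0 where
  toFun x := (⟨(x.1.1.1, x.1.2.1.1, x.1.2.2.1), by
      have h := x.2
      rw [LinearMap.mem_ker, differential_apply, Prod.mk_eq_zero] at h ⊢
      exact ⟨congrArg Prod.fst h.1, congrArg Prod.fst h.2⟩⟩,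
    ⟨(x.1.1.2, x.1.2.1.2, x.1.2.2.2), by
      have h := x.2
      rw [LinearMap.mem_ker, differential_apply, Prod.mk_eq_zero] at h ⊢
      exact ⟨congrArg Prod.snd h.1, congrArg Prod.snd h.2⟩⟩)
  map_add' _ _ := rfl
  map_smul' _ _ := rfl
  invFun y := ⟨((y.1.1.1, y.2.1.1), (y.1.1.2.1, y.2.1.2.1), (y.1.1.2.2, y.2.1.2.2)), by
      have h := y.1.2
      have h' := y.2.2
      rw [LinearMap.mem_ker, differential_apply, Prod.mk_eq_zero] at h h' ⊢
      exact ⟨Prod.ext h.1 h'.1, Prod.ext h.2 h'.2⟩⟩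
  left_inv _ := rfl
  right_inv _ := rfl

/-- The map from the target of the differential of `F ⊕ G` to `H¹(F) ⊕ H¹(G)`. -/
def H1SumMap (F G : KDiagram k) :
    ((F.sum G).A1 × (F.sum G).A2) →ₗ[k] F.H1 × G.H1 :=
  ((Submodule.mkQ _).prodMap (Submodule.mkQ _)) ∘ₗ
    (LinearEquiv.prodProdProdComm k F.A1 G.A1 F.A2 G.A2).toLinearMap

/-- `H¹` commutes with direct sums. -/
noncomputable def H1Sum (F G : KDiagram k) : (F.sum G).H1 ≃ₗ[k] F.H1 × G.H1 :=
  (Submodule.quotEquivOfEq _ _ (by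
    ext y
    have key : y ∈ LinearMap.ker (H1SumMap F G) ↔
        (y.1.1, y.2.1) ∈ LinearMap.range F.differential ∧
          (y.1.2, y.2.2) ∈ LinearMap.range G.differential := by
      rw [LinearMap.mem_ker, ← Submodule.Quotient.mk_eq_zero, ← Submodule.Quotient.mk_eq_zero]
      exact Prod.ext_iff
    rw [key]
    constructor
    · rintro ⟨x, rfl⟩
      exact ⟨⟨(x.1.1, x.2.1.1, x.2.2.1), rfl⟩, ⟨(x.1.2, x.2.1.2, x.2.2.2), rfl⟩⟩
    · rintro ⟨⟨x, hx⟩, ⟨x', hx'⟩⟩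
      refine ⟨((x.1, x'.1), (x.2.1, x'.2.1), (x.2.2, x'.2.2)), ?_⟩
      rw [differential_apply, Prod.ext_iff] at hx hx'
      exact Prod.ext (Prod.ext hx.1 hx'.1) (Prod.ext hx.2 hx'.2))).trans
  (LinearMap.quotKerEquivOfSurjective (H1SumMap F G)
    ((Function.Surjective.prodMap (Submodule.mkQ_surjective _) (Submodule.mkQ_surjective _)).comp
      (LinearEquiv.surjective _)))

theorem IsFredholm.sum {F G : KDiagram k} (hF : F.IsFredholm) (hG : G.IsFredholm) :
    (F.sum G).IsFredholm := by
  have := hF.1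
  have := hF.2
  have := hG.1
  have := hG.2
  exact ⟨Module.Finite.equiv (H0Sum F G).symm, Module.Finite.equiv (H1Sum F G).symm⟩

theorem b0_sum {F G : KDiagram k} (hF : F.IsFredholm) (hG : G.IsFredholm) :
    (F.sum G).b0 = F.b0 + G.b0 := by
  have := hF.1
  have := hG.1
  exact (H0Sum F G).finrank_eq.trans Module.finrank_prod

theorem b1_sum {F G : KDiagram k} (hF : F.IsFredholm) (hG : G.IsFredholm) :
    (F.sum G).b1 = F.b1 + G.b1 := by
  have := hF.2
  have := hG.2
  exact (H1Sum F G).finrank_eq.trans Module.finrank_prod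

theorem Iso.b0_eq {F G : KDiagram k} (e : Iso F G) : F.b0 = G.b0 := e.H0Equiv.finrank_eq

theorem Iso.b1_eq {F G : KDiagram k} (e : Iso F G) : F.b1 = G.b1 := e.H1Equiv.finrank_eq

theorem IsFredholm.directSum {ι : Type} [Finite ι] {F : ι → KDiagram k}
    (hF : ∀ i, (F i).IsFredholm) : (directSum F).IsFredholm := by
  classical
  have := Fintype.ofFinite ι
  have h0 := fun i => (hF i).1
  have h1 := fun i => (hF i).2
  constructor
  · let φ : (KDiagram.directSum F).H0 →ₗ[k] (∀ i, (F i).H0) :=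
      LinearMap.pi fun i => LinearMap.codRestrict _
        (((DirectSum.component k ι (fun i => (F i).B1) i).prodMap
          ((DirectSum.component k ι (fun i => (F i).B2) i).prodMap
            (DirectSum.component k ι (fun i => (F i).B3) i))) ∘ₗ Submodule.subtype _)
        (by
          intro x
          have h := x.2
          rw [LinearMap.mem_ker, differential_apply, Prod.mk_eq_zero] at h ⊢
          exact ⟨congrArg (DirectSum.component k ι (fun i => (F i).A1) i) h.1,
            congrArg (DirectSum.component k ι (fun i => (F i).A2) i) h.2⟩)
    refine Module.Finite.of_injective φ ?_
    intro x y hxy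
    have h := fun i => congrArg Subtype.val (congrFun hxy i)
    refine Subtype.ext (Prod.ext ?_ (Prod.ext ?_ ?_))
    · exact DFinsupp.ext fun i => congrArg Prod.fst (h i)
    · exact DFinsupp.ext fun i => congrArg (fun z => z.2.1) (h i)
    · exact DFinsupp.ext fun i => congrArg (fun z => z.2.2) (h i)
  · let ψ : ((KDiagram.directSum F).A1 × (KDiagram.directSum F).A2) →ₗ[k] (∀ i, (F i).H1) :=
      LinearMap.pi fun i => Submodule.mkQ _ ∘ₗ
        ((DirectSum.component k ι (fun i => (F i).A1) i).prodMap
          (DirectSum.component k ι (fun i => (F i).A2) i))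
    have hker : LinearMap.ker ψ ≤ LinearMap.range (KDiagram.directSum F).differential := by
      intro y hy
      have hy' : ∀ i, ∃ x, (F i).differential x =
          (DirectSum.component k ι (fun i => (F i).A1) i y.1,
            DirectSum.component k ι (fun i => (F i).A2) i y.2) := fun i =>
        (Submodule.Quotient.mk_eq_zero _).1 (congrFun (LinearMap.mem_ker.1 hy) i)
      choose x hx using hy'
      refine ⟨(DFinsupp.equivFunOnFintype.symm fun i => (x i).1,
        DFinsupp.equivFunOnFintype.symm fun i => (x i).2.1,
        DFinsupp.equivFunOnFintype.symm fun i => (x i).2.2), ?_⟩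
      exact Prod.ext (DFinsupp.ext fun i => congrArg Prod.fst (hx i))
        (DFinsupp.ext fun i => congrArg Prod.snd (hx i))
    have : Module.Finite k (((KDiagram.directSum F).A1 × (KDiagram.directSum F).A2) ⧸
        LinearMap.ker ψ) :=
      Module.Finite.equiv ψ.quotKerEquivRange.symm
    exact Module.Finite.of_surjective (Submodule.factor hker) (Submodule.factor_surjective hker)

/-! ### `M_{W,d}` is Fredholm for a perfect matching `W` -/

theorem isFredholm_MInt (k : Type u) [Field k] {W : ℤ × ℤ → ℤ} (hW : IsPerfectMatching W)
    (d : ℤ × ℤ) : (MInt k W d).IsFredholm := by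
  classical
  obtain ⟨⟨a, ha⟩, ⟨b, hb⟩, π, hπ⟩ := hW
  let V : ℤ × ℤ → ℕ∞ := fun c => ((W c).toNat : ℕ∞)
  have hle : ∀ i, a ≤ i + π i := fun i => by
    by_contra h
    have := ha (i, π i) (by simp only [deg]; omega)
    simp [hπ] at this
  have hge : ∀ i, i + π i ≤ b := fun i => by
    by_contra h
    have := hb (i, π i) (by simp only [deg]; omega)
    simp [hπ] at this
  have hp : ∀ p : Multi V, p.1.1.2 = π p.1.1.1 ∧ p.1.2 = 1 := by
    rintro ⟨⟨⟨i, j⟩, n⟩, h1, h2⟩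
    have h3 : n ≤ (W (i, j)).toNat := by
      have h2' : (n : ℕ∞) ≤ ((W (i, j)).toNat : ℕ∞) := h2
      exact_mod_cast h2'
    rw [hπ] at h3
    dsimp only at h1 ⊢
    split_ifs at h3 with h
    · exact ⟨h, by simp at h3; omega⟩
    · simp at h3; omega
  have hinj : Function.Injective fun p : Multi V => p.1.1.1 := by
    intro p q h
    have hq := hp q
    have hp := hp p
    dsimp only at h
    refine Subtype.ext (Prod.ext (Prod.ext h ?_) ?_)
    · rw [hp.1, hq.1, h]
    · rw [hp.2, hq.2]
  let m : ℤ → Multi V := fun i => ⟨((i, π i), 1), le_rfl, by simp [V, hπ]⟩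
  obtain ⟨T, hdiff, hfin⟩ : ∃ T : (({i : ℤ // i ≤ d.1} →₀ k) × ({j : ℤ // j ≤ d.2} →₀ k) ×
      (Multi V →₀ k)) →ₗ[k] ((ℤ →₀ k) × (ℤ →₀ k)), (∀ x, T x =
      (Finsupp.mapDomain Subtype.val x.1 - Finsupp.mapDomain (fun p : Multi V => p.1.1.1) x.2.2,
        Finsupp.mapDomain Subtype.val x.2.1 -
          Finsupp.mapDomain (fun p : Multi V => p.1.1.2) x.2.2)) ∧
      (Module.Finite k (LinearMap.ker T) ∧
        Module.Finite k (((ℤ →₀ k) × (ℤ →₀ k)) ⧸ LinearMap.range T) → (M k V d).IsFredholm) :=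
    ⟨(M k V d).differential, fun _ => rfl, fun h => h⟩
  refine hfin ?_
  have hsub : ∀ c : ℤ, ∀ x : {i : ℤ // i ≤ c} →₀ k, ∀ j, c < j →
      Finsupp.mapDomain Subtype.val x j = 0 := by
    intro c x j hj
    refine Finsupp.mapDomain_of_notMem_range _ _ ?_
    rintro ⟨y, rfl⟩
    exact absurd y.2 (not_le.2 hj)
  have hinj2 : Function.Injective fun p : Multi V => p.1.1.2 := by
    intro p q h
    have hq := (hp q).1
    have hp := (hp p).1
    dsimp only at h
    exact hinj (π.injective (by dsimp only; rw [← hp, ← hq, h]))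
  constructor
  · let S : Finset ℤ := Finset.Icc (a - d.2) d.1
    let φ : LinearMap.ker T →ₗ[k] (S → k) :=
      LinearMap.pi fun i => (Finsupp.lapply (m i)) ∘ₗ (LinearMap.snd k _ _ ∘ₗ
        LinearMap.snd k _ _) ∘ₗ Submodule.subtype _
    suffices hφ : ∀ x, φ x = 0 → x = 0 from Module.Finite.of_injective φ fun x y h =>
      sub_eq_zero.1 (hφ (x - y) ((φ.map_sub x y).trans (sub_eq_zero.2 h)))
    rintro ⟨⟨x1, x2, x3⟩, hx⟩ h
    rw [LinearMap.mem_ker, hdiff, Prod.mk_eq_zero, sub_eq_zero, sub_eq_zero] at hx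
    dsimp only at hx
    have h3 : x3 = 0 := by
      refine Finsupp.ext fun (p : Multi V) => ?_
      have e1 := DFunLike.congr_fun hx.1 p.1.1.1
      have e2 := DFunLike.congr_fun hx.2 p.1.1.2
      have q1 : Finsupp.mapDomain (fun p : Multi V => p.1.1.1) x3 p.1.1.1 = x3 p :=
        Finsupp.mapDomain_apply hinj x3 p
      have q2 : Finsupp.mapDomain (fun p : Multi V => p.1.1.2) x3 p.1.1.2 = x3 p :=
        Finsupp.mapDomain_apply hinj2 x3 p
      rw [q1] at e1
      rw [q2] at e2
      by_cases hc1 : d.1 < p.1.1.1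
      · exact e1.symm.trans (hsub _ _ _ hc1)
      by_cases hc2 : d.2 < p.1.1.2
      · exact e2.symm.trans (hsub _ _ _ hc2)
      have hpm : p = m p.1.1.1 := hinj rfl
      have hmem : p.1.1.1 ∈ S := by
        have := hle p.1.1.1
        have := (hp p).1
        simp only [S, Finset.mem_Icc]
        omega
      rw [hpm]
      exact congrFun h ⟨p.1.1.1, hmem⟩
    subst h3
    have h1 : x1 = 0 := Finsupp.mapDomain_injective Subtype.val_injective
      (hx.1.trans (by simp only [Finsupp.mapDomain_zero]))
    have h2 : x2 = 0 := Finsupp.mapDomain_injective Subtype.val_injective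
      (hx.2.trans (by simp only [Finsupp.mapDomain_zero]))
    subst h1 h2
    rfl
  · let S : Finset ℤ := Finset.Icc (d.1 + 1) (b - d.2)
    let R := LinearMap.range T
    let φ : (S → k) →ₗ[k] ((ℤ →₀ k) × (ℤ →₀ k)) ⧸ R :=
      (Fintype.linearCombination k fun i : S =>
        R.mkQ ((Finsupp.single (i : ℤ) (1 : k), 0) : (ℤ →₀ k) × (ℤ →₀ k)))
    have hA1 : ∀ i : ℤ,
        R.mkQ ((Finsupp.single i (1 : k), 0) : (ℤ →₀ k) × (ℤ →₀ k)) ∈ LinearMap.range φ := by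
      intro i
      by_cases h1 : i ≤ d.1
      · have : R.mkQ ((Finsupp.single i (1 : k), 0) : (ℤ →₀ k) × (ℤ →₀ k)) = 0 := by
          refine (Submodule.Quotient.mk_eq_zero _).2 ⟨(Finsupp.single ⟨i, h1⟩ 1, 0, 0), ?_⟩
          rw [hdiff]
          simp
        rw [this]
        exact zero_mem _
      by_cases h2 : π i ≤ d.2
      · have : R.mkQ ((Finsupp.single i (1 : k), 0) : (ℤ →₀ k) × (ℤ →₀ k)) = 0 := by
          refine (Submodule.Quotient.mk_eq_zero _).2
            ⟨(0, Finsupp.single ⟨π i, h2⟩ (-1), Finsupp.single (m i) (-1)), ?_⟩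
          rw [hdiff]
          simp only [Finsupp.mapDomain_single, Finsupp.mapDomain_zero]
          simp [m]
        rw [this]
        exact zero_mem _
      · have hi : i ∈ S := by
          have := hge i
          simp only [S, Finset.mem_Icc]
          omega
        exact ⟨Pi.single ⟨i, hi⟩ 1, by simp [φ]⟩
    have hA2 : ∀ j : ℤ,
        R.mkQ ((0, Finsupp.single j (1 : k)) : (ℤ →₀ k) × (ℤ →₀ k)) ∈ LinearMap.range φ := by
      intro j
      have : R.mkQ ((0, Finsupp.single j (1 : k)) : (ℤ →₀ k) × (ℤ →₀ k)) =
          - R.mkQ ((Finsupp.single (π.symm j) (1 : k), 0) : (ℤ →₀ k) × (ℤ →₀ k)) := by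
        rw [eq_neg_iff_add_eq_zero, ← map_add]
        refine (Submodule.Quotient.mk_eq_zero _).2
            ⟨(0, 0, Finsupp.single (m (π.symm j)) (-1)), ?_⟩
        rw [hdiff]
        simp only [Finsupp.mapDomain_single, Finsupp.mapDomain_zero]
        simp [m]
      rw [this]
      exact neg_mem (hA1 _)
    refine Module.Finite.of_surjective φ (LinearMap.range_eq_top.1 (eq_top_iff.2 ?_))
    rintro y -
    obtain ⟨⟨y1, y2⟩, rfl⟩ := Submodule.mkQ_surjective _ y
    have e1 : ∀ y1 : ℤ →₀ k,
        R.mkQ ((y1, 0) : (ℤ →₀ k) × (ℤ →₀ k)) ∈ LinearMap.range φ := by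
      intro y1
      induction y1 using Finsupp.induction_linear with
      | zero => exact zero_mem _
      | add f g hf hg =>
        have := add_mem hf hg
        rw [← map_add] at this
        simpa using this
      | single i c =>
        have := Submodule.smul_mem _ c (hA1 i)
        rw [← map_smul] at this
        simpa using this
    have e2 : ∀ y2 : ℤ →₀ k,
        R.mkQ ((0, y2) : (ℤ →₀ k) × (ℤ →₀ k)) ∈ LinearMap.range φ := by
      intro y2
      induction y2 using Finsupp.induction_linear with
      | zero => exact zero_mem _
      | add f g hf hg =>
        have := add_mem hf hg
        rw [← map_add] at this
        simpa using this
      | single i c =>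
        have := Submodule.smul_mem _ c (hA2 i)
        rw [← map_smul] at this
        simpa using this
    have := add_mem (e1 y1) (e2 y2)
    rw [← map_add] at this
    simpa using this

end KDiagram

/-! ### Virtual Fredholm `k`-diagrams -/

/-- Fredholm `k`-diagrams. -/
def FredholmDiagram (k : Type u) [Field k] : Type (u + 1) := {F : KDiagram k // F.IsFredholm}

/-- A virtual (Fredholm) `k`-diagram: a formal difference `pos ⊖ neg` of Fredholm `k`-diagrams. -/
structure VirtualDiagram (k : Type u) [Field k] where
  pos : FredholmDiagram k
  neg : FredholmDiagram k

namespace VirtualDiagram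

variable {k : Type u} [Field k]

/-- `(F₁, F₂) ∼ (F₁', F₂')` iff `F₁ ⊕ F₂' ⊕ F₀ ≃ F₁' ⊕ F₂ ⊕ F₀` for some Fredholm `F₀`. -/
def Equivalent (X Y : VirtualDiagram k) : Prop :=
  ∃ F0 : FredholmDiagram k, Nonempty (KDiagram.Iso
    ((X.pos.1.sum Y.neg.1).sum F0.1) ((Y.pos.1.sum X.neg.1).sum F0.1))

theorem equivalent_trans {X Y Z : VirtualDiagram k} (h : Equivalent X Y) (h' : Equivalent Y Z) :
    Equivalent X Z := by
  obtain ⟨F, e⟩ := h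
  obtain ⟨G, e'⟩ := h'
  refine ⟨⟨(Y.neg.1.sum F.1).sum (Y.pos.1.sum G.1),
    (Y.neg.2.sum F.2).sum (Y.pos.2.sum G.2)⟩, ?_⟩
  rw [← KDiagram.toIsoClass_eq_iff] at e e' ⊢
  simp only [KDiagram.toIsoClass_sum] at e e' ⊢
  generalize X.pos.1.toIsoClass = a at *
  generalize X.neg.1.toIsoClass = b at *
  generalize Y.pos.1.toIsoClass = c at *
  generalize Y.neg.1.toIsoClass = p at *
  generalize Z.pos.1.toIsoClass = q at *
  generalize Z.neg.1.toIsoClass = r at *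
  generalize F.1.toIsoClass = s at *
  generalize G.1.toIsoClass = t at *
  calc a + r + (p + s + (c + t)) = (a + p + s) + (c + r + t) := by ac_rfl
    _ = (c + b + s) + (q + p + t) := by rw [e, e']
    _ = q + b + (p + s + (c + t)) := by ac_rfl

/-- Equivalence of virtual diagrams as a setoid. -/
instance setoid (k : Type u) [Field k] : Setoid (VirtualDiagram k) where
  r := Equivalent
  iseqv :=
    { refl := fun X => ⟨X.pos, ⟨KDiagram.Iso.refl _⟩⟩
      symm := fun ⟨F, ⟨e⟩⟩ => ⟨F, ⟨e.symm⟩⟩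
      trans := equivalent_trans }

/-- `b⁰(F₁ ⊖ F₂) = b⁰(F₁) - b⁰(F₂)`. -/
noncomputable def b0 (X : VirtualDiagram k) : ℤ := (X.pos.1.b0 : ℤ) - X.neg.1.b0

/-- `b¹(F₁ ⊖ F₂) = b¹(F₁) - b¹(F₂)`. -/
noncomputable def b1 (X : VirtualDiagram k) : ℤ := (X.pos.1.b1 : ℤ) - X.neg.1.b1

theorem b0_eq_of_equivalent (X Y : VirtualDiagram k) (h : Equivalent X Y) : X.b0 = Y.b0 := by
  obtain ⟨F, ⟨e⟩⟩ := h
  have := e.b0_eq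
  rw [KDiagram.b0_sum (X.pos.2.sum Y.neg.2) F.2, KDiagram.b0_sum X.pos.2 Y.neg.2,
    KDiagram.b0_sum (Y.pos.2.sum X.neg.2) F.2, KDiagram.b0_sum Y.pos.2 X.neg.2] at this
  simp only [b0]
  omega

theorem b1_eq_of_equivalent (X Y : VirtualDiagram k) (h : Equivalent X Y) : X.b1 = Y.b1 := by
  obtain ⟨F, ⟨e⟩⟩ := h
  have := e.b1_eq
  rw [KDiagram.b1_sum (X.pos.2.sum Y.neg.2) F.2, KDiagram.b1_sum X.pos.2 Y.neg.2,
    KDiagram.b1_sum (Y.pos.2.sum X.neg.2) F.2, KDiagram.b1_sum Y.pos.2 X.neg.2] at this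
  simp only [b1]
  omega

end VirtualDiagram

/-- Equivalence classes of virtual Fredholm `k`-diagrams. -/
def VirtualClass (k : Type u) [Field k] : Type (u + 1) := Quotient (VirtualDiagram.setoid k)

namespace VirtualClass

variable {k : Type u} [Field k]

/-- The zeroth Betti number of a class of virtual Fredholm `k`-diagrams. -/
noncomputable def b0 (c : VirtualClass k) : ℤ :=
  Quotient.lift VirtualDiagram.b0 VirtualDiagram.b0_eq_of_equivalent c

/-- The first Betti number of a class of virtual Fredholm `k`-diagrams. -/
noncomputable def b1 (c : VirtualClass k) : ℤ :=
  Quotient.lift VirtualDiagram.b1 VirtualDiagram.b1_eq_of_equivalent c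

/-- The Euler characteristic of a class of virtual Fredholm `k`-diagrams. -/
noncomputable def eulerChar (c : VirtualClass k) : ℤ := c.b0 - c.b1

end VirtualClass

namespace MatchingDecomposition

/-- The virtual Fredholm `k`-diagram
`(M_{W_1,d} ⊕ ⋯ ⊕ M_{W_s,d}) ⊖ (M_{W̃_1,d} ⊕ ⋯ ⊕ M_{W̃_{s-1},d})`. -/
noncomputable def virtualDiagram {W : ℤ × ℤ → ℤ} (D : MatchingDecomposition W)
    (k : Type u) [Field k] (d : ℤ × ℤ) : VirtualDiagram k where
  pos := ⟨KDiagram.directSum fun i => KDiagram.MInt k (D.pos i) d,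
    KDiagram.IsFredholm.directSum fun i => KDiagram.isFredholm_MInt k (D.pos_matching i) d⟩
  neg := ⟨KDiagram.directSum fun i => KDiagram.MInt k (D.neg i) d,
    KDiagram.IsFredholm.directSum fun i => KDiagram.isFredholm_MInt k (D.neg_matching i) d⟩

/-- The class `[M_{W,d}]` obtained from a given way of writing `W`. -/
noncomputable def virtualClass {W : ℤ × ℤ → ℤ} (D : MatchingDecomposition W)
    (k : Type u) [Field k] (d : ℤ × ℤ) : VirtualClass k :=
  Quotient.mk (VirtualDiagram.setoid k) (D.virtualDiagram k d)

end MatchingDecomposition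

/-! The diagram of a perfect matching is a direct sum of small pieces, one for each point of its
graph. The piece at a point `p` is one-dimensional at `B₃`, `A₁` and `A₂`, and one-dimensional at
`B_i` exactly when `p_i ≤ d_i`. Hence a finite direct sum of matching diagrams is determined up to
isomorphism by the multiset of its points, that is, by the sum of the matchings
(`nonempty_iso_sum_directSum_MInt`). Two ways of writing `W` give `pos + neg' = pos' + neg`, and
this equality of multisets is already the required equivalence (`virtualClass_eq`).

A piece has `b⁰ = 1` if `p ≤ d` and `b¹ = 1` if both coordinates of `p` exceed those of `d`; all its
other Betti numbers vanish (`b0_pointDiagram`, `b1_pointDiagram`). So `b⁰` counts points below `d`,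
and the signed count over a decomposition is the sum of `W` below `d`, which is `f d`.

For `b¹`, raise `d₂` to a large `N`. Every matching has exactly `N - d₂` points with second
coordinate in `(d₂, N]`; each of them is either newly below `(d₁, N)` or was strictly above `d` in
both coordinates (`ncard_points_le_add`). As there is one more positive matching than negative ones,
the signed count gives `f d + (N - d₂) = f (d₁, N) + b¹`. The right-hand side is `d₁ + N + C + b¹`
for large `N`, so `b¹ = f d - deg d - C`. -/

namespace KDiagram

variable {k : Type u} [Field k]

/-! ### Diagrams spanned by sets -/

section OfMaps

variable {X₁ X₂ X₃ Y₁ Y₂ X₁' X₂' X₃' Y₁' Y₂' : Type}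

/-- The `k`-diagram of free vector spaces on a diagram of sets. -/
noncomputable def ofMaps (k : Type u) [Field k]
    (f₁₁ : X₁ → Y₁) (f₂₂ : X₂ → Y₂) (f₃₁ : X₃ → Y₁) (f₃₂ : X₃ → Y₂) : KDiagram k where
  B1 := X₁ →₀ k
  B2 := X₂ →₀ k
  B3 := X₃ →₀ k
  A1 := Y₁ →₀ k
  A2 := Y₂ →₀ k
  r11 := Finsupp.lmapDomain k k f₁₁
  r22 := Finsupp.lmapDomain k k f₂₂
  r31 := Finsupp.lmapDomain k k f₃₁
  r32 := Finsupp.lmapDomain k k f₃₂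

theorem lmapDomain_domLCongr {X Y X' Y' : Type} (f : X → Y) (f' : X' → Y') (e : X ≃ X')
    (e' : Y ≃ Y') (h : ∀ x, f' (e x) = e' (f x)) (z : X →₀ k) :
    Finsupp.lmapDomain k k f' (Finsupp.domLCongr (R := k) e z) =
      Finsupp.domLCongr (R := k) e' (Finsupp.lmapDomain k k f z) := by
  simp only [Finsupp.domLCongr_apply, Finsupp.domCongr_apply, Finsupp.lmapDomain_apply,
    Finsupp.equivMapDomain_eq_mapDomain, ← Finsupp.mapDomain_comp]
  congr 1
  exact funext h

/-- An isomorphism of diagrams of sets induces an isomorphism of `k`-diagrams. -/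
noncomputable def ofMapsCongr {f₁₁ : X₁ → Y₁} {f₂₂ : X₂ → Y₂} {f₃₁ : X₃ → Y₁} {f₃₂ : X₃ → Y₂}
    {f₁₁' : X₁' → Y₁'} {f₂₂' : X₂' → Y₂'} {f₃₁' : X₃' → Y₁'} {f₃₂' : X₃' → Y₂'}
    (e₁ : X₁ ≃ X₁') (e₂ : X₂ ≃ X₂') (e₃ : X₃ ≃ X₃') (ε₁ : Y₁ ≃ Y₁') (ε₂ : Y₂ ≃ Y₂')
    (h₁₁ : ∀ x, f₁₁' (e₁ x) = ε₁ (f₁₁ x)) (h₂₂ : ∀ x, f₂₂' (e₂ x) = ε₂ (f₂₂ x))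
    (h₃₁ : ∀ x, f₃₁' (e₃ x) = ε₁ (f₃₁ x)) (h₃₂ : ∀ x, f₃₂' (e₃ x) = ε₂ (f₃₂ x)) :
    Iso (ofMaps k f₁₁ f₂₂ f₃₁ f₃₂) (ofMaps k f₁₁' f₂₂' f₃₁' f₃₂') where
  eB1 := Finsupp.domLCongr e₁
  eB2 := Finsupp.domLCongr e₂
  eB3 := Finsupp.domLCongr e₃
  eA1 := Finsupp.domLCongr ε₁
  eA2 := Finsupp.domLCongr ε₂
  comm11 := lmapDomain_domLCongr _ _ _ _ h₁₁
  comm22 := lmapDomain_domLCongr _ _ _ _ h₂₂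
  comm31 := lmapDomain_domLCongr _ _ _ _ h₃₁
  comm32 := lmapDomain_domLCongr _ _ _ _ h₃₂

theorem prodMap_lmapDomain_sumFinsupp {X Y X' Y' : Type} (f : X → Y) (f' : X' → Y')
    (z : X ⊕ X' →₀ k) :
    (Finsupp.lmapDomain k k f).prodMap (Finsupp.lmapDomain k k f')
        (Finsupp.sumFinsuppLEquivProdFinsupp k z) =
      Finsupp.sumFinsuppLEquivProdFinsupp k (Finsupp.lmapDomain k k (Sum.map f f') z) := by
  classical
  induction z using Finsupp.induction_linear with
  | zero => simp
  | add a b ha hb => simp only [map_add, ha, hb]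
  | single x c =>
    obtain x | x := x <;> simp [Finsupp.mapDomain_single]

/-- The direct sum of two diagrams spanned by sets is spanned by the disjoint unions. -/
noncomputable def sumOfMaps (f₁₁ : X₁ → Y₁) (f₂₂ : X₂ → Y₂) (f₃₁ : X₃ → Y₁) (f₃₂ : X₃ → Y₂)
    (f₁₁' : X₁' → Y₁') (f₂₂' : X₂' → Y₂') (f₃₁' : X₃' → Y₁') (f₃₂' : X₃' → Y₂') :
    Iso (ofMaps k (Sum.map f₁₁ f₁₁') (Sum.map f₂₂ f₂₂') (Sum.map f₃₁ f₃₁') (Sum.map f₃₂ f₃₂'))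
      ((ofMaps k f₁₁ f₂₂ f₃₁ f₃₂).sum (ofMaps k f₁₁' f₂₂' f₃₁' f₃₂')) where
  eB1 := Finsupp.sumFinsuppLEquivProdFinsupp k
  eB2 := Finsupp.sumFinsuppLEquivProdFinsupp k
  eB3 := Finsupp.sumFinsuppLEquivProdFinsupp k
  eA1 := Finsupp.sumFinsuppLEquivProdFinsupp k
  eA2 := Finsupp.sumFinsuppLEquivProdFinsupp k
  comm11 := prodMap_lmapDomain_sumFinsupp _ _
  comm22 := prodMap_lmapDomain_sumFinsupp _ _
  comm31 := prodMap_lmapDomain_sumFinsupp _ _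
  comm32 := prodMap_lmapDomain_sumFinsupp _ _

end OfMaps

section DirectSum

variable {α : Type} {X₁ X₂ X₃ Y₁ Y₂ : α → Type}

/-- By linearity it suffices to compare basis vectors: each is sent to a basis vector of the summand
with the same index. -/
theorem lmap_lmapDomain_sigmaFinsupp {X Y : α → Type} (f : ∀ a, X a → Y a)
    (z : (Σ a, X a) →₀ k) :
    DirectSum.lmap (fun a => Finsupp.lmapDomain k k (f a)) (sigmaFinsuppLequivDFinsupp k z) =
      sigmaFinsuppLequivDFinsupp k (Finsupp.lmapDomain k k (Sigma.map id f) z) := by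
  classical
  induction z using Finsupp.induction_linear with
  | zero => simp only [map_zero]
  | add a b ha hb => simp only [map_add, ha, hb]
  | single x c =>
    have key : ∀ (Z : α → Type) (y : Σ a, Z a), sigmaFinsuppLequivDFinsupp k (Finsupp.single y c) =
        DirectSum.lof k α (fun a => Z a →₀ k) y.1 (Finsupp.single y.2 c) :=
      fun Z y => sigmaFinsuppEquivDFinsupp_single y c
    rw [Finsupp.lmapDomain_apply, Finsupp.mapDomain_single, key, key, DirectSum.lmap_lof,
      Finsupp.lmapDomain_apply, Finsupp.mapDomain_single]
    rfl

/-- The direct sum of diagrams spanned by sets is spanned by the disjoint unions. -/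
noncomputable def directSumOfMaps (f₁₁ : ∀ a, X₁ a → Y₁ a) (f₂₂ : ∀ a, X₂ a → Y₂ a)
    (f₃₁ : ∀ a, X₃ a → Y₁ a) (f₃₂ : ∀ a, X₃ a → Y₂ a) :
    Iso (ofMaps k (Sigma.map id f₁₁) (Sigma.map id f₂₂) (Sigma.map id f₃₁) (Sigma.map id f₃₂))
      (directSum fun a => ofMaps k (f₁₁ a) (f₂₂ a) (f₃₁ a) (f₃₂ a)) where
  eB1 := sigmaFinsuppLequivDFinsupp k
  eB2 := sigmaFinsuppLequivDFinsupp k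
  eB3 := sigmaFinsuppLequivDFinsupp k
  eA1 := sigmaFinsuppLequivDFinsupp k
  eA2 := sigmaFinsuppLequivDFinsupp k
  comm11 := lmap_lmapDomain_sigmaFinsupp _
  comm22 := lmap_lmapDomain_sigmaFinsupp _
  comm31 := lmap_lmapDomain_sigmaFinsupp _
  comm32 := lmap_lmapDomain_sigmaFinsupp _

end DirectSum

/-! ### Diagrams of families of points -/

section PointDiagram

variable {ι ι' : Type}

/-- The direct sum over `x : ι` of the diagrams with one-dimensional values at `B₃`, `A₁`, `A₂`,
and with one-dimensional value at `B_i` if `(p x)_i ≤ d_i` and zero otherwise. -/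
noncomputable def pointDiagram (k : Type u) [Field k] (p : ι → ℤ × ℤ) (d : ℤ × ℤ) : KDiagram k :=
  ofMaps k (Subtype.val : {x // (p x).1 ≤ d.1} → ι) (Subtype.val : {x // (p x).2 ≤ d.2} → ι)
    (id : ι → ι) (id : ι → ι)

/-- Relabelling a family of points. -/
noncomputable def pointDiagramCongr {p : ι → ℤ × ℤ} {p' : ι' → ℤ × ℤ} (e : ι ≃ ι')
    (h : ∀ x, p' (e x) = p x) (d : ℤ × ℤ) : Iso (pointDiagram k p d) (pointDiagram k p' d) :=
  ofMapsCongr (e.subtypeEquiv fun x => by rw [h]) (e.subtypeEquiv fun x => by rw [h]) e e e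
    (fun _ => rfl) (fun _ => rfl) (fun _ => rfl) (fun _ => rfl)

/-- Direct sums of point diagrams correspond to disjoint unions of families of points. -/
noncomputable def pointDiagramSum (p : ι → ℤ × ℤ) (p' : ι' → ℤ × ℤ) (d : ℤ × ℤ) :
    Iso (pointDiagram k (Sum.elim p p') d) ((pointDiagram k p d).sum (pointDiagram k p' d)) :=
  (ofMapsCongr (Equiv.subtypeSum (p := fun x => (Sum.elim p p' x).1 ≤ d.1))
    (Equiv.subtypeSum (p := fun x => (Sum.elim p p' x).2 ≤ d.2)) (Equiv.refl _) (Equiv.refl _)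
    (Equiv.refl _) (by rintro ⟨x | x, hx⟩ <;> rfl) (by rintro ⟨x | x, hx⟩ <;> rfl)
    (by rintro (x | x) <;> rfl) (by rintro (x | x) <;> rfl)).trans (sumOfMaps _ _ _ _ _ _ _ _)

/-- A subtype of a sigma type as a sigma type of subtypes. -/
def subtypeSigma {α : Type} {X : α → Type} (q : ∀ a, X a → Prop) :
    {y : Σ a, X a // q y.1 y.2} ≃ Σ a, {x // q a x} where
  toFun y := ⟨y.1.1, y.1.2, y.2⟩
  invFun y := ⟨⟨y.1, y.2.1⟩, y.2.2⟩

/-- Direct sums of point diagrams correspond to disjoint unions of families of points. -/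
noncomputable def pointDiagramDirectSum {α : Type} {X : α → Type} (p : ∀ a, X a → ℤ × ℤ)
    (d : ℤ × ℤ) :
    Iso (pointDiagram k (fun y : Σ a, X a => p y.1 y.2) d)
      (directSum fun a => pointDiagram k (p a) d) :=
  let e := directSumOfMaps (k := k) (fun a => (Subtype.val : {x // (p a x).1 ≤ d.1} → X a))
    (fun a => (Subtype.val : {x // (p a x).2 ≤ d.2} → X a)) (fun _ => id) (fun _ => id)
  Iso.trans (ofMapsCongr (subtypeSigma fun a x => (p a x).1 ≤ d.1)
    (subtypeSigma fun a x => (p a x).2 ≤ d.2) (Equiv.refl (Σ a, X a)) (Equiv.refl (Σ a, X a))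
    (Equiv.refl (Σ a, X a)) (fun _ => rfl) (fun _ => rfl) (fun _ => rfl) (fun _ => rfl)) e

/-- A perfect matching gives the diagram of the points in the graph of its permutation. -/
noncomputable def MIntIso (k : Type u) [Field k] {W : ℤ × ℤ → ℤ} {π : Equiv.Perm ℤ}
    (hπ : ∀ i j, W (i, j) = if j = π i then 1 else 0) (d : ℤ × ℤ) :
    Iso (MInt k W d) (pointDiagram k (fun i => (i, π i)) d) :=
  -- The multiplicity index runs from 1 up to the weight, so a weight with values 0 and 1 leaves the
  -- single index 1 over each point of the graph.
  have hp : ∀ p : Multi fun a => ((W a).toNat : ℕ∞), p.1.1.2 = π p.1.1.1 ∧ p.1.2 = 1 := by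
    rintro ⟨⟨⟨i, j⟩, n⟩, h1, h2⟩
    have h3 : n ≤ (W (i, j)).toNat := by
      have h2' : (n : ℕ∞) ≤ ((W (i, j)).toNat : ℕ∞) := h2
      exact_mod_cast h2'
    rw [hπ] at h3
    dsimp only at h1 ⊢
    split_ifs at h3 with h
    · exact ⟨h, by simp at h3; omega⟩
    · simp at h3; omega
  -- Relabelling `B₂` and `A₂` by `π⁻¹` indexes all five spaces by the first coordinate, which turns
  -- both maps out of `B₃` into identities.
  ofMapsCongr (Equiv.refl _)
    (π.symm.subtypeEquiv fun j => by simp)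
    { toFun p := p.1.1.1
      invFun i := ⟨((i, π i), 1), le_rfl, by simp [hπ]⟩
      left_inv p := Subtype.ext (Prod.ext (Prod.ext rfl (hp p).1.symm) (hp p).2.symm)
      right_inv _ := rfl }
    (Equiv.refl _) π.symm (fun _ => rfl) (fun _ => rfl) (fun _ => rfl)
    (fun p => (π.symm_apply_eq.2 (hp p).1).symm)

/-- The direct sum of isomorphisms. -/
noncomputable def Iso.directSumCongr {α : Type} {F G : α → KDiagram k} (e : ∀ a, Iso (F a) (G a)) :
    Iso (KDiagram.directSum F) (KDiagram.directSum G) where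
  eB1 := DFinsupp.mapRange.linearEquiv fun a => (e a).eB1
  eB2 := DFinsupp.mapRange.linearEquiv fun a => (e a).eB2
  eB3 := DFinsupp.mapRange.linearEquiv fun a => (e a).eB3
  eA1 := DFinsupp.mapRange.linearEquiv fun a => (e a).eA1
  eA2 := DFinsupp.mapRange.linearEquiv fun a => (e a).eA2
  comm11 (x : ⨁ a, (F a).B1) := DFinsupp.ext fun a => (e a).comm11 (x a)
  comm22 (x : ⨁ a, (F a).B2) := DFinsupp.ext fun a => (e a).comm22 (x a)
  comm31 (x : ⨁ a, (F a).B3) := DFinsupp.ext fun a => (e a).comm31 (x a)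
  comm32 (x : ⨁ a, (F a).B3) := DFinsupp.ext fun a => (e a).comm32 (x a)

/-- A direct sum of diagrams of perfect matchings is a point diagram. -/
noncomputable def directSumMIntIso (k : Type u) [Field k] {α : Type} {V : α → ℤ × ℤ → ℤ}
    {π : α → Equiv.Perm ℤ} (hπ : ∀ a i j, V a (i, j) = if j = π a i then 1 else 0) (d : ℤ × ℤ) :
    Iso (directSum fun a => MInt k (V a) d)
      (pointDiagram k (fun y : Σ _ : α, ℤ => (y.2, π y.1 y.2)) d) :=
  (Iso.directSumCongr fun a => MIntIso k (hπ a) d).trans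
    (pointDiagramDirectSum (fun a i => (i, π a i)) d).symm

/-! ### Betti numbers of point diagrams -/

theorem mapDomain_val_subtypeDomain {q : ι → Prop} {z : ι →₀ k} (h : ∀ x, ¬ q x → z x = 0) :
    Finsupp.mapDomain Subtype.val (z.subtypeDomain q) = z := by
  ext x
  by_cases hx : q x
  · exact Finsupp.mapDomain_apply Subtype.val_injective _ (⟨x, hx⟩ : Subtype q)
  · rw [h x hx]
    refine Finsupp.mapDomain_of_notMem_range _ _ ?_
    rintro ⟨y, rfl⟩
    exact hx y.2

theorem mapDomain_val_apply_of_not {q : ι → Prop} (z : Subtype q →₀ k) {x : ι} (hx : ¬ q x) :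
    Finsupp.mapDomain Subtype.val z x = 0 := by
  refine Finsupp.mapDomain_of_notMem_range _ _ ?_
  rintro ⟨y, rfl⟩
  exact hx y.2

/-- No finiteness is required: both sides are 0 by convention when `ι` is infinite. -/
theorem finrank_finsupp_eq_natCard (k : Type u) [Field k] (ι : Type) :
    Module.finrank k (ι →₀ k) = Nat.card ι :=
  Module.finrank_eq_nat_card_basis Finsupp.basisSingleOne

/-- Both maps out of `B₃` are identities, so a kernel element is determined by its `B₃` component.
That component must come from both `B₁` and `B₂`, so it is supported on the points below `d`, and
every such vector occurs. -/
theorem b0_pointDiagram (k : Type u) [Field k] (p : ι → ℤ × ℤ) (d : ℤ × ℤ) :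
    (pointDiagram k p d).b0 = Nat.card {x // p x ≤ d} := by
  rw [← finrank_finsupp_eq_natCard k]
  let φ : (pointDiagram k p d).H0 →ₗ[k] ({x // p x ≤ d} →₀ k) :=
    Finsupp.lsubtypeDomain {x | p x ≤ d} ∘ₗ LinearMap.snd k _ _ ∘ₗ LinearMap.snd k _ _ ∘ₗ
      Submodule.subtype _
  refine (LinearEquiv.ofBijective φ ⟨?_, ?_⟩).finrank_eq
  · refine (injective_iff_map_eq_zero φ).2 ?_
    rintro ⟨⟨x1, x2, x3⟩, hx⟩ h
    rw [LinearMap.mem_ker, differential_apply, Prod.mk_eq_zero, sub_eq_zero, sub_eq_zero] at hx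
    have hx1 : Finsupp.mapDomain Subtype.val x1 = x3 := hx.1.trans Finsupp.mapDomain_id
    have hx2 : Finsupp.mapDomain Subtype.val x2 = x3 := hx.2.trans Finsupp.mapDomain_id
    have h3 : x3 = 0 := by
      refine Finsupp.ext fun (x : ι) => ?_
      by_cases h1 : (p x).1 ≤ d.1
      · by_cases h2 : (p x).2 ≤ d.2
        · exact DFunLike.congr_fun h ⟨x, h1, h2⟩
        · rw [← hx2]
          exact mapDomain_val_apply_of_not _ h2
      · rw [← hx1]
        exact mapDomain_val_apply_of_not _ h1
    subst h3
    have h1 : x1 = 0 := Finsupp.mapDomain_injective Subtype.val_injective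
      (hx1.trans Finsupp.mapDomain_zero.symm)
    have h2 : x2 = 0 := Finsupp.mapDomain_injective Subtype.val_injective
      (hx2.trans Finsupp.mapDomain_zero.symm)
    subst h1 h2
    rfl
  · intro z
    let y : ι →₀ k := Finsupp.mapDomain Subtype.val z
    refine ⟨⟨(y.subtypeDomain _, y.subtypeDomain _, y), ?_⟩, ?_⟩
    · rw [LinearMap.mem_ker, differential_apply, Prod.mk_eq_zero, sub_eq_zero, sub_eq_zero]
      refine ⟨(mapDomain_val_subtypeDomain fun x hx => ?_).trans Finsupp.mapDomain_id.symm,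
        (mapDomain_val_subtypeDomain fun x hx => ?_).trans Finsupp.mapDomain_id.symm⟩
      · exact mapDomain_val_apply_of_not _ fun h => hx h.1
      · exact mapDomain_val_apply_of_not _ fun h => hx h.2
    · exact Finsupp.ext fun x => Finsupp.mapDomain_apply Subtype.val_injective _ x

/-- Dividing by the diagonal image of `B₃` identifies `A₁ × A₂` with one copy of the free space via
`(a, b) ↦ a - b`. Dividing further by `B₁` and `B₂` kills every point with `p_1 ≤ d_1` or `p_2 ≤
d_2`. -/
theorem b1_pointDiagram (k : Type u) [Field k] (p : ι → ℤ × ℤ) (d : ℤ × ℤ) :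
    (pointDiagram k p d).b1 = Nat.card {x // d.1 < (p x).1 ∧ d.2 < (p x).2} := by
  classical
  rw [← finrank_finsupp_eq_natCard k]
  let S : Set ι := {x | d.1 < (p x).1 ∧ d.2 < (p x).2}
  let ψ : ((pointDiagram k p d).A1 × (pointDiagram k p d).A2) →ₗ[k] (S →₀ k) :=
    Finsupp.lsubtypeDomain S ∘ₗ (LinearMap.fst k (ι →₀ k) (ι →₀ k) - LinearMap.snd k _ _)
  have hψ : ∀ (y : (ι →₀ k) × (ι →₀ k)) x, ψ y x = y.1 x.1 - y.2 x.1 := fun _ _ => rfl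
  have hsurj : Function.Surjective ψ := fun z =>
    ⟨((Finsupp.mapDomain Subtype.val z : ι →₀ k), (0 : ι →₀ k)), Finsupp.ext fun x =>
      (hψ _ _).trans ((sub_zero _).trans (Finsupp.mapDomain_apply Subtype.val_injective z x))⟩
  refine ((Submodule.quotEquivOfEq _ _ ?_).trans
    (ψ.quotKerEquivOfSurjective hsurj)).finrank_eq
  refine le_antisymm ?_ ?_
  · rintro _ ⟨⟨x1, x2, x3⟩, rfl⟩
    rw [LinearMap.mem_ker]
    refine Finsupp.ext fun x => (hψ _ _).trans ?_
    have e1 : Finsupp.mapDomain Subtype.val x1 x.1 = (0 : k) :=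
      mapDomain_val_apply_of_not _ (not_le.2 x.2.1)
    have e2 : Finsupp.mapDomain Subtype.val x2 x.1 = (0 : k) :=
      mapDomain_val_apply_of_not _ (not_le.2 x.2.2)
    change (Finsupp.mapDomain Subtype.val x1 x.1 - Finsupp.mapDomain id x3 x.1) -
      (Finsupp.mapDomain Subtype.val x2 x.1 - Finsupp.mapDomain id x3 x.1) = (0 : k)
    rw [e1, e2, sub_self]
  · rintro ⟨(a : ι →₀ k), (b : ι →₀ k)⟩ h
    have h' : ∀ x, d.1 < (p x).1 → d.2 < (p x).2 → a x = b x := fun x h1 h2 =>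
      sub_eq_zero.1 (DFunLike.congr_fun (LinearMap.mem_ker.1 h) (⟨x, h1, h2⟩ : S))
    -- `B₁` absorbs the part `v` of `a - b` where the first coordinate is at most `d₁`. The rest,
    -- with opposite sign, is `w`; it comes from `B₂` because `a` and `b` agree at the points
    -- strictly above `d`. Taking `v - a` in `B₃` then gives `v - (v - a) = a` and `w - (v - a) =
    -- b`.
    let v : ι →₀ k := (a - b).filter fun x => (p x).1 ≤ d.1
    let w : ι →₀ k := v - (a - b)
    refine ⟨(v.subtypeDomain _, w.subtypeDomain _, v - a), ?_⟩
    have e1 : Finsupp.mapDomain Subtype.val (v.subtypeDomain fun x => (p x).1 ≤ d.1) = v :=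
      mapDomain_val_subtypeDomain fun x hx => Finsupp.filter_apply_neg _ _ hx
    have e2 : Finsupp.mapDomain Subtype.val (w.subtypeDomain fun x => (p x).2 ≤ d.2) = w := by
      refine mapDomain_val_subtypeDomain fun x hx => ?_
      by_cases h1 : (p x).1 ≤ d.1
      · simp [w, v, h1]
      · simp [w, v, h1, h' x (not_le.1 h1) (not_le.1 hx)]
    change (Finsupp.mapDomain Subtype.val (v.subtypeDomain fun x => (p x).1 ≤ d.1) -
      Finsupp.mapDomain id (v - a),
      Finsupp.mapDomain Subtype.val (w.subtypeDomain fun x => (p x).2 ≤ d.2) -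
      Finsupp.mapDomain id (v - a)) = (a, b)
    rw [e1, e2, Finsupp.mapDomain_id]
    refine Prod.ext (sub_sub_cancel v a) ?_
    simp [w]

end PointDiagram

end KDiagram

/-! ### Counting points of perfect matchings -/

/-- Two families with finite fibres of the same cardinalities agree up to relabelling. -/
theorem exists_equiv_of_natCard_fiber_eq {ι ι' γ : Type} {p : ι → γ} {p' : ι' → γ}
    (hp : ∀ c, Finite {x // p x = c}) (hp' : ∀ c, Finite {x // p' x = c})
    (h : ∀ c, Nat.card {x // p x = c} = Nat.card {x // p' x = c}) :
    ∃ e : ι ≃ ι', ∀ x, p' (e x) = p x :=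
  ⟨Equiv.ofFiberEquiv fun c => Classical.choice (Finite.card_eq.1 (h c)),
    fun x => Equiv.ofFiberEquiv_map _ x⟩

/-- Summing over `{c | c ≤ d}` a function that vanishes in small degrees. -/
theorem finsum_mem_Iic_eq_sum_Icc {g : ℤ × ℤ → ℤ} {a : ℤ} (ha : ∀ c, deg c ≤ a → g c = 0)
    (d : ℤ × ℤ) :
    ∑ᶠ c ∈ Set.Iic d, g c = ∑ c ∈ Finset.Icc (a - d.2, a - d.1) d, g c := by
  -- If `c ≤ d` and `deg c > a`, then `c₁ > a - c₂ ≥ a - d₂` and symmetrically `c₂ > a - d₁`; this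
  -- is the lower corner of the box.
  refine finsum_mem_eq_sum_of_inter_support_eq _ ?_
  ext c
  simp only [Set.mem_inter_iff, Set.mem_Iic, Function.mem_support, Finset.coe_Icc, Set.mem_Icc,
    and_congr_left_iff]
  intro hc
  refine ⟨fun h => ⟨?_, h⟩, fun h => h.2⟩
  have hd : a < deg c := not_le.1 fun h' => hc (ha c h')
  have h1 := h.1
  have h2 := h.2
  simp only [deg] at hd
  exact ⟨by dsimp only; omega, by dsimp only; omega⟩

section Matching

variable {V : ℤ × ℤ → ℤ} {π : Equiv.Perm ℤ}

theorem lt_add_apply_of_initiallyZero (hπ : ∀ i j, V (i, j) = if j = π i then 1 else 0) {a : ℤ}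
    (ha : ∀ c, deg c ≤ a → V c = 0) (i : ℤ) : a < i + π i := by
  by_contra h
  have := ha (i, π i) (by simp only [deg]; omega)
  simp [hπ] at this

theorem add_apply_lt_of_eventuallyZero (hπ : ∀ i j, V (i, j) = if j = π i then 1 else 0) {b : ℤ}
    (hb : ∀ c, b ≤ deg c → V c = 0) (i : ℤ) : i + π i < b := by
  by_contra h
  have := hb (i, π i) (by simp only [deg]; omega)
  simp [hπ] at this

/-- A lower bound on degrees together with `π i ≤ d₂` bounds `i` from below. -/
theorem finite_points_le {a : ℤ} (ha : ∀ i, a < i + π i) (d : ℤ × ℤ) :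
    {i : ℤ | i ≤ d.1 ∧ π i ≤ d.2}.Finite := by
  refine (Set.finite_Icc (a - d.2) d.1).subset fun i hi => ?_
  have := ha i
  have h1 := hi.1
  have h2 := hi.2
  exact ⟨by omega, h1⟩

theorem finite_points_gt {b : ℤ} (hb : ∀ i, i + π i < b) (d : ℤ × ℤ) :
    {i : ℤ | d.1 < i ∧ d.2 < π i}.Finite := by
  refine (Set.finite_Icc d.1 (b - d.2)).subset fun i hi => ?_
  have := hb i
  have h1 := hi.1
  have h2 := hi.2
  exact ⟨h1.le, by omega⟩

/-- The values of the Riemann function of a perfect matching count the points below `d`. -/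
theorem finsum_matching_eq_ncard (hπ : ∀ i j, V (i, j) = if j = π i then 1 else 0) {a : ℤ}
    (ha : ∀ i, a < i + π i) (d : ℤ × ℤ) :
    ∑ᶠ c ∈ Set.Iic d, V c = ({i : ℤ | i ≤ d.1 ∧ π i ≤ d.2}.ncard : ℤ) := by
  classical
  have hfin := finite_points_le ha d
  have hinj : Function.Injective fun i : ℤ => (i, π i) := fun i j h => congrArg Prod.fst h
  rw [Set.ncard_eq_toFinset_card _ hfin,
    finsum_mem_eq_sum_of_inter_support_eq (t := hfin.toFinset.image fun i => (i, π i)) V ?_,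
    Finset.sum_image hinj.injOn]
  · simp [hπ]
  · ext ⟨i, j⟩
    simp only [Set.mem_inter_iff, Set.mem_Iic, Function.mem_support, hπ, Finset.coe_image,
      Set.Finite.coe_toFinset, Set.mem_image, Set.mem_ofPred_eq, Prod.le_def, Prod.mk.injEq]
    aesop

/-- Passing from `(d₁, d₂)` to `(d₁, N)`, each of the `N - d₂` points with second coordinate in
`(d₂, N]` either is a new point below, or was a point above. -/
theorem ncard_points_le_add {a b : ℤ} (ha : ∀ i, a < i + π i) (hb : ∀ i, i + π i < b)
    {d : ℤ × ℤ} {N : ℤ} (hN : d.2 ≤ N) (hbN : b ≤ d.1 + N) :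
    ({i : ℤ | i ≤ d.1 ∧ π i ≤ d.2}.ncard : ℤ) + (N - d.2) =
      {i : ℤ | i ≤ d.1 ∧ π i ≤ N}.ncard + {i : ℤ | d.1 < i ∧ d.2 < π i}.ncard := by
  -- This is where bijectivity of `π` enters: every second coordinate is attained exactly once.
  have hcard : ((π ⁻¹' Set.Ioc d.2 N).ncard : ℤ) = N - d.2 := by
    rw [← Equiv.image_symm_eq_preimage, Set.ncard_image_of_injective _ π.symm.injective,
      ← Finset.coe_Ioc, Set.ncard_coe_finset, Int.card_Ioc, Int.toNat_of_nonneg (by omega)]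
  have hfin : (π ⁻¹' Set.Ioc d.2 N).Finite := (Set.finite_Ioc _ _).preimage π.injective.injOn
  rw [← hcard]
  norm_cast
  rw [← Set.ncard_union_eq _ (finite_points_le ha d) hfin,
    ← Set.ncard_union_eq _ (finite_points_le ha (d.1, N)) (finite_points_gt hb d)]
  · congr 1
    ext i
    -- A point strictly above `d` has `π i < b - i < b - d₁ ≤ N`, so its second coordinate does lie
    -- in `(d₂, N]`.
    have := hb i
    simp only [Set.mem_union, Set.mem_ofPred_eq, Set.mem_preimage, Set.mem_Ioc]
    omega
  · refine Set.disjoint_left.2 fun i h h' => ?_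
    exact absurd h.1 (not_le.2 h'.1)
  · refine Set.disjoint_left.2 fun i h h' => ?_
    exact absurd h.2 (not_le.2 h'.1)

end Matching

/-- Finitely many perfect matchings are graphs of permutations and have common bounds for the
degrees of their points. -/
theorem exists_perm_of_isPerfectMatching {α : Type} [Finite α] {V : α → ℤ × ℤ → ℤ}
    (hV : ∀ x, IsPerfectMatching (V x)) :
    ∃ (π : α → Equiv.Perm ℤ) (a b : ℤ), (∀ x i j, V x (i, j) = if j = π x i then 1 else 0) ∧
      (∀ x i, a < i + π x i) ∧ ∀ x i, i + π x i < b := by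
  choose ha hb π hπ using hV
  choose a ha using ha
  choose b hb using hb
  obtain ⟨a', ha'⟩ := Finite.exists_ge a
  obtain ⟨b', hb'⟩ := Finite.exists_le b
  exact ⟨π, a', b', hπ,
    fun x i => (ha' x).trans_lt (lt_add_apply_of_initiallyZero (hπ x) (ha x) i),
    fun x i => (add_apply_lt_of_eventuallyZero (hπ x) (hb x) i).trans_le (hb' x)⟩

/-! ### Betti numbers and point multiplicities of finite families of matchings -/

namespace KDiagram

section Family

variable {α : Type} [Fintype α] {V : α → ℤ × ℤ → ℤ} {π : α → Equiv.Perm ℤ}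

theorem b0_directSum_MInt (k : Type u) [Field k]
    (hπ : ∀ x i j, V x (i, j) = if j = π x i then 1 else 0)
    {a : ℤ} (ha : ∀ x i, a < i + π x i) (d : ℤ × ℤ) :
    (directSum fun x => MInt k (V x) d).b0 = ∑ x, {i : ℤ | i ≤ d.1 ∧ π x i ≤ d.2}.ncard := by
  rw [(directSumMIntIso k hπ d).b0_eq, b0_pointDiagram]
  have : ∀ x, Finite {i : ℤ // i ≤ d.1 ∧ π x i ≤ d.2} := fun x => finite_points_le (ha x) d
  exact (Nat.card_congr (subtypeSigma fun x i => i ≤ d.1 ∧ π x i ≤ d.2)).trans Nat.card_sigma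

theorem b1_directSum_MInt (k : Type u) [Field k]
    (hπ : ∀ x i j, V x (i, j) = if j = π x i then 1 else 0)
    {b : ℤ} (hb : ∀ x i, i + π x i < b) (d : ℤ × ℤ) :
    (directSum fun x => MInt k (V x) d).b1 = ∑ x, {i : ℤ | d.1 < i ∧ d.2 < π x i}.ncard := by
  rw [(directSumMIntIso k hπ d).b1_eq, b1_pointDiagram]
  have : ∀ x, Finite {i : ℤ // d.1 < i ∧ d.2 < π x i} := fun x => finite_points_gt (hb x) d
  exact (Nat.card_congr (subtypeSigma fun x i => d.1 < i ∧ d.2 < π x i)).trans Nat.card_sigma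

theorem b0_directSum_MInt_eq_finsum (k : Type u) [Field k] (hV : ∀ x, IsPerfectMatching (V x))
    (d : ℤ × ℤ) :
    ((directSum fun x => MInt k (V x) d).b0 : ℤ) = ∑ᶠ c ∈ Set.Iic d, ∑ x, V x c := by
  obtain ⟨π, a, b, hπ, ha, hb⟩ := exists_perm_of_isPerfectMatching hV
  have hz : ∀ x c, deg c ≤ a → V x c = 0 := by
    rintro x ⟨i, j⟩ hc
    rw [hπ, if_neg]
    rintro rfl
    exact absurd hc (not_le.2 (ha x i))
  -- The common degree bound `a` gives one finite box for all the matchings, so the sums over points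
  -- and over matchings can be exchanged.
  rw [b0_directSum_MInt k hπ ha d, finsum_mem_Iic_eq_sum_Icc
    (fun c hc => Finset.sum_eq_zero fun x _ => hz x c hc), Finset.sum_comm]
  push_cast
  refine Finset.sum_congr rfl fun x _ => ?_
  rw [← finsum_mem_Iic_eq_sum_Icc (hz x), finsum_matching_eq_ncard (hπ x) (ha x)]

/-- The variation of the Betti numbers in the second coordinate. -/
theorem exists_b0_add_eq_b0_add_b1 (k : Type u) [Field k] (hV : ∀ x, IsPerfectMatching (V x)) :
    ∃ b : ℤ, ∀ (d : ℤ × ℤ) (N : ℤ), d.2 ≤ N → b ≤ d.1 + N →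
      ((directSum fun x => MInt k (V x) d).b0 : ℤ) + Fintype.card α * (N - d.2) =
        (directSum fun x => MInt k (V x) (d.1, N)).b0 +
          (directSum fun x => MInt k (V x) d).b1 := by
  obtain ⟨π, a, b, hπ, ha, hb⟩ := exists_perm_of_isPerfectMatching hV
  refine ⟨b, fun d N hN hbN => ?_⟩
  rw [b0_directSum_MInt k hπ ha, b0_directSum_MInt k hπ ha, b1_directSum_MInt k hπ hb]
  -- Each matching contributes the same `N - d₂`, so the total involves the number of matchings.
  have := Finset.sum_congr (rfl : (Finset.univ : Finset α) = _) fun x _ =>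
    ncard_points_le_add (ha x) (hb x) hN hbN
  rw [Finset.sum_add_distrib, Finset.sum_add_distrib, Finset.sum_const, Finset.card_univ,
    nsmul_eq_mul] at this
  push_cast
  exact this

/-- Each matching passes through `c` at most once. Finiteness is what lets equal values of
`Nat.card` produce bijections of fibres. -/
theorem finite_fiber (π : α → Equiv.Perm ℤ) (c : ℤ × ℤ) :
    Finite {y : Σ _ : α, ℤ // (y.2, π y.1 y.2) = c} := by
  refine Finite.of_injective (fun y => y.1.1) ?_
  rintro ⟨⟨x, i⟩, rfl⟩ ⟨⟨x', i'⟩, h⟩ (rfl : x = x')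
  obtain rfl : i' = i := congrArg Prod.fst h
  rfl

/-- The fibre over `c` is the set of matchings through `c`, and each of these adds 1 to the total
weight. Thus the total weight records the multiset of points. -/
theorem natCard_fiber (hπ : ∀ x i j, V x (i, j) = if j = π x i then 1 else 0) (c : ℤ × ℤ) :
    (Nat.card {y : Σ _ : α, ℤ // (y.2, π y.1 y.2) = c} : ℤ) = ∑ x, V x c := by
  obtain ⟨i, j⟩ := c
  have e : {y : Σ _ : α, ℤ // (y.2, π y.1 y.2) = (i, j)} ≃ {x : α // j = π x i} :=
    { toFun y := ⟨y.1.1, (congrArg Prod.snd y.2).symm.trans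
        (congrArg (π y.1.1) (congrArg Prod.fst y.2))⟩
      invFun x := ⟨⟨x.1, i⟩, Prod.ext rfl x.2.symm⟩
      left_inv := by
        rintro ⟨⟨x, i'⟩, h⟩
        obtain rfl : i' = i := congrArg Prod.fst h
        rfl
      right_inv _ := rfl }
  simp only [Nat.card_congr e, hπ]
  simp [Fintype.card_subtype]

end Family

/-- The direct sum of two direct sums of perfect matchings depends only on the total weight. -/
theorem nonempty_iso_sum_directSum_MInt (k : Type u) [Field k] {α β α' β' : Type} [Fintype α]
    [Fintype β] [Fintype α'] [Fintype β'] {V : α → ℤ × ℤ → ℤ} {U : β → ℤ × ℤ → ℤ}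
    {V' : α' → ℤ × ℤ → ℤ} {U' : β' → ℤ × ℤ → ℤ} (hV : ∀ x, IsPerfectMatching (V x))
    (hU : ∀ x, IsPerfectMatching (U x)) (hV' : ∀ x, IsPerfectMatching (V' x))
    (hU' : ∀ x, IsPerfectMatching (U' x))
    (h : ∀ c, ∑ x, V x c + ∑ x, U x c = ∑ x, V' x c + ∑ x, U' x c) (d : ℤ × ℤ) :
    Nonempty (Iso
      ((directSum fun x => MInt k (V x) d).sum (directSum fun x => MInt k (U x) d))
      ((directSum fun x => MInt k (V' x) d).sum (directSum fun x => MInt k (U' x) d))) := by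
  obtain ⟨π, -, -, hπ, -, -⟩ := exists_perm_of_isPerfectMatching hV
  obtain ⟨σ, -, -, hσ, -, -⟩ := exists_perm_of_isPerfectMatching hU
  obtain ⟨π', -, -, hπ', -, -⟩ := exists_perm_of_isPerfectMatching hV'
  obtain ⟨σ', -, -, hσ', -, -⟩ := exists_perm_of_isPerfectMatching hU'
  have fin : ∀ {ι ι' : Type} {p : ι → ℤ × ℤ} {p' : ι' → ℤ × ℤ} (c : ℤ × ℤ),
      Finite {x // p x = c} → Finite {x // p' x = c} →
      Finite {x // Sum.elim p p' x = c} ∧ Nat.card {x // Sum.elim p p' x = c} =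
        Nat.card {x // p x = c} + Nat.card {x // p' x = c} := fun {ι ι' p p'} c _ _ =>
    have e : {x // Sum.elim p p' x = c} ≃ {x // p x = c} ⊕ {x // p' x = c} := Equiv.subtypeSum
    ⟨Finite.of_equiv _ e.symm, (Nat.card_congr e).trans Nat.card_sum⟩
  have fin₁ := fun c => fin c (finite_fiber π c) (finite_fiber σ c)
  have fin₂ := fun c => fin c (finite_fiber π' c) (finite_fiber σ' c)
  -- Equal total weights mean equal multiplicities at every point, so the two families of points
  -- differ by a relabelling. It need not respect the individual matchings.
  obtain ⟨e, he⟩ := exists_equiv_of_natCard_fiber_eq (fun c => (fin₁ c).1) (fun c => (fin₂ c).1)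
    fun c => by
      rw [(fin₁ c).2, (fin₂ c).2]
      zify
      rw [natCard_fiber hπ, natCard_fiber hσ, natCard_fiber hπ', natCard_fiber hσ', h]
  exact ⟨(((directSumMIntIso k hπ d).sumCongr (directSumMIntIso k hσ d)).trans
    (pointDiagramSum _ _ d).symm).trans ((pointDiagramCongr e he d).trans
      ((pointDiagramSum _ _ d).trans
        ((directSumMIntIso k hπ' d).symm.sumCongr (directSumMIntIso k hσ' d).symm)))⟩

end KDiagram

/-! ### Virtual classes of decompositions and their Betti numbers -/

namespace MatchingDecomposition

variable {W : ℤ × ℤ → ℤ}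

theorem virtualClass_eq (D D' : MatchingDecomposition W) (k : Type u) [Field k] (d : ℤ × ℤ) :
    D.virtualClass k d = D'.virtualClass k d := by
  obtain ⟨e⟩ := KDiagram.nonempty_iso_sum_directSum_MInt k D.pos_matching D'.neg_matching
    D'.pos_matching D.neg_matching (fun c => by
      have h := congrFun (D.eq_sub.symm.trans D'.eq_sub) c
      simp only [Pi.sub_apply, Finset.sum_apply] at h
      omega) d
  -- The isomorphism exists without stabilization, so any Fredholm diagram may serve as the added
  -- summand.
  exact Quotient.sound ⟨(D.virtualDiagram k d).pos, ⟨e.sumCongr (KDiagram.Iso.refl _)⟩⟩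

theorem b0_virtualClass (D : MatchingDecomposition W) (k : Type u) [Field k] (d : ℤ × ℤ) :
    (D.virtualClass k d).b0 = ∑ᶠ c ∈ Set.Iic d, W c := by
  have hzero : ∀ {n : ℕ} {V : Fin n → ℤ × ℤ → ℤ}, (∀ x, IsPerfectMatching (V x)) →
      ∃ a, ∀ c, deg c ≤ a → ∑ x, V x c = 0 := by
    intro n V hV
    choose a ha using fun x => (hV x).1
    obtain ⟨a', ha'⟩ := Finite.exists_ge a
    exact ⟨a', fun c hc => Finset.sum_eq_zero fun x _ => ha x c (hc.trans (ha' x))⟩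
  obtain ⟨a, ha⟩ := hzero D.pos_matching
  obtain ⟨a', ha'⟩ := hzero D.neg_matching
  have ha₁ : ∀ c, deg c ≤ min a a' → ∑ x, D.pos x c = 0 := fun c hc =>
    ha c (hc.trans (min_le_left _ _))
  have ha₂ : ∀ c, deg c ≤ min a a' → ∑ x, D.neg x c = 0 := fun c hc =>
    ha' c (hc.trans (min_le_right _ _))
  have hW : ∀ c, W c = ∑ x, D.pos x c - ∑ x, D.neg x c := fun c => by
    rw [congrFun D.eq_sub c]
    simp only [Pi.sub_apply, Finset.sum_apply]
  change ((KDiagram.directSum fun i => KDiagram.MInt k (D.pos i) d).b0 : ℤ) -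
    (KDiagram.directSum fun i => KDiagram.MInt k (D.neg i) d).b0 = _
  rw [KDiagram.b0_directSum_MInt_eq_finsum k D.pos_matching,
    KDiagram.b0_directSum_MInt_eq_finsum k D.neg_matching, finsum_mem_Iic_eq_sum_Icc ha₁,
    finsum_mem_Iic_eq_sum_Icc ha₂, finsum_mem_Iic_eq_sum_Icc (g := W) (a := min a a')
      (fun c hc => by rw [hW, ha₁ c hc, ha₂ c hc, sub_zero]), ← Finset.sum_sub_distrib]
  exact Finset.sum_congr rfl fun c _ => (hW c).symm

/-- This is the difference of the counting identities for the positive and the negative matchings.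
The coefficient of `N - d₂` is `(t + 1) - t = 1`. -/
theorem exists_b1_virtualClass (D : MatchingDecomposition W) (k : Type u) [Field k] :
    ∃ b : ℤ, ∀ (d : ℤ × ℤ) (N : ℤ), d.2 ≤ N → b ≤ d.1 + N →
      (D.virtualClass k d).b1 =
        (D.virtualClass k d).b0 - (D.virtualClass k (d.1, N)).b0 + (N - d.2) := by
  obtain ⟨b, hb⟩ := KDiagram.exists_b0_add_eq_b0_add_b1 k D.pos_matching
  obtain ⟨b', hb'⟩ := KDiagram.exists_b0_add_eq_b0_add_b1 k D.neg_matching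
  refine ⟨max b b', fun d N hN hbN => ?_⟩
  have h := hb d N hN ((le_max_left _ _).trans hbN)
  have h' := hb' d N hN ((le_max_right _ _).trans hbN)
  change ((KDiagram.directSum fun i => KDiagram.MInt k (D.pos i) d).b1 : ℤ) -
    (KDiagram.directSum fun i => KDiagram.MInt k (D.neg i) d).b1 =
    (((KDiagram.directSum fun i => KDiagram.MInt k (D.pos i) d).b0 : ℤ) -
    (KDiagram.directSum fun i => KDiagram.MInt k (D.neg i) d).b0) -
    (((KDiagram.directSum fun i => KDiagram.MInt k (D.pos i) (d.1, N)).b0 : ℤ) -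
    (KDiagram.directSum fun i => KDiagram.MInt k (D.neg i) (d.1, N)).b0) + (N - d.2)
  rw [Fintype.card_fin] at h h'
  push_cast at h
  linarith

end MatchingDecomposition

theorem mainTheorem4 (k : Type u) [Field k] (f : ℤ × ℤ → ℤ) (C : ℤ)
    (hf : IsRiemannFunction f C) (W : ℤ × ℤ → ℤ) (hW : IsWeight f W) (d : ℤ × ℤ) :
    (∀ D D' : MatchingDecomposition W, D.virtualClass k d = D'.virtualClass k d) ∧
    ∀ D : MatchingDecomposition W,
      f d = (D.virtualClass k d).b0 ∧
      (∀ K : ℤ × ℤ, dualFunction f C K (K - d) = (D.virtualClass k d).b1) ∧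
      (D.virtualClass k d).eulerChar = deg d + C := by
  refine ⟨fun D D' => D.virtualClass_eq D' k d, fun D => ?_⟩
  have h0 : ∀ d, f d = (D.virtualClass k d).b0 := fun d =>
    (hW.2 d).trans (D.b0_virtualClass k d).symm
  have h1 : (D.virtualClass k d).b1 = f d - deg d - C := by
    obtain ⟨b, hb⟩ := hf.2
    obtain ⟨b', hb'⟩ := D.exists_b1_virtualClass k
    -- `N` is large enough for the counting identity at `d` and for `f (d₁, N) = d₁ + N + C`; it
    -- then cancels.
    let N := max d.2 (max (b - d.1) (b' - d.1))
    have hN : b ≤ d.1 + N ∧ b' ≤ d.1 + N := by omega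
    rw [hb' d N (le_max_left _ _) hN.2, ← h0, ← h0, hb (d.1, N) hN.1]
    simp only [deg]
    ring
  refine ⟨h0 d, fun K => ?_, ?_⟩
  -- Since `K - (K - d) = d`, the value of the dual function is `f d - deg d - C` whatever `K` is.
  · rw [h1, dualFunction, sub_sub_cancel]
  · rw [VirtualClass.eulerChar, h1, ← h0]
    ring
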